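/- Let $q$ be a prime power, let $n\ge 2$ be an integer, and let $\gamma,\beta\in[0,1]$ be real numbers. For an integer $1\le k\le n$ and real $m,\beta$, call a set $K\subseteq\mathbb{F}_q^n$ a $(k,m,\beta)$-Furstenberg set if for at least a $\beta$-fraction of all $k$-dimensional linear subspaces $A\subseteq\mathbb{F}_q^n$ there exists $a\in\mathbb{F}_q^n$ such that $|(a+A)\cap K|\ge m$. Then every $(2,\gamma q^2,\beta)$-Furstenberg set $K\subseteq\mathbb{F}_q^n$ satisfies $$|K|\ \ge\ \beta\,\gamma^n q^n\left(1+\frac1q\right)^{-n}.$$ -/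

import Mathlib

namespace Furstenberg

/-- The set of `k`-dimensional linear subspaces of `F^n` (flats through the origin). -/
def subspaces (F : Type*) [Field F] (n k : ℕ) : Set (Submodule F (Fin n → F)) :=
  {A | Module.finrank F A = k}

/-- The shift `a + A` of a subspace `A`, as a set of points. -/
def shift {F : Type*} [Field F] {n : ℕ} (a : Fin n → F) (A : Submodule F (Fin n → F)) :
    Set (Fin n → F) :=
  (fun x => a + x) '' (A : Set (Fin n → F))

/-- `R` is `m`-rich with respect to `S` if `|R ∩ S| ≥ m`. -/
def IsRich {F : Type*} [Field F] {n : ℕ} (m : ℝ) (S R : Set (Fin n → F)) : Prop :=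
  m ≤ ((R ∩ S).ncard : ℝ)

/-- `K ⊆ F^n` (with `F` finite) is `(k, m, β)`-Furstenberg if at least a `β`-fraction of all
`k`-dimensional subspaces `A` have a shift `a + A` that is `m`-rich with respect to `K`. -/
def IsFurstenberg {F : Type*} [Field F] {n : ℕ} (k : ℕ) (m β : ℝ) (K : Set (Fin n → F)) : Prop :=
  β * ((subspaces F n k).ncard : ℝ) ≤
    ({A ∈ subspaces F n k | ∃ a : Fin n → F, IsRich m K (shift a A)}.ncard : ℝ)

end Furstenberg

namespace Furstenberg

open MvPolynomial

section Graded

variable {σ L : Type*} [Field L]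

theorem aeval_mem_of_isHomogeneous {A : Type*} [CommRing A] [Algebra L A]
    (𝒜 : ℕ → Submodule L A) [SetLike.GradedMonoid 𝒜] {f : σ → A} (hf : ∀ i, f i ∈ 𝒜 1)
    {P : MvPolynomial σ L} {k : ℕ} (hP : P.IsHomogeneous k) : aeval f P ∈ 𝒜 k := by
  rw [aeval_def, eval₂_eq]
  refine Submodule.sum_mem _ fun e he => ?_
  rw [← Algebra.smul_def]
  refine Submodule.smul_mem _ _ ?_
  have hk : ∑ i ∈ e.support, e i * 1 = k := by
    have := hP.degree_eq_sum_deg_support he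
    simpa using this.symm
  rw [← hk]
  exact SetLike.prod_mem_graded 𝒜 _ _ fun i _ => SetLike.pow_mem_graded (e i) (hf i)

/-- Bihomogeneous polynomials: those of total degree exactly `k` in outer and inner variables. -/
def mvGrading (σ L : Type*) [Field L] (k : ℕ) :
    Submodule L (MvPolynomial σ (MvPolynomial σ L)) where
  carrier := {W | ∀ c b, coeff b (coeff c W) ≠ 0 → b.degree + c.degree = k}
  zero_mem' := by simp
  add_mem' := by
    intro V W hV hW c b h
    by_contra hne
    have h1 : coeff b (coeff c V) = 0 := by by_contra h'; exact hne (hV c b h')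
    have h2 : coeff b (coeff c W) = 0 := by by_contra h'; exact hne (hW c b h')
    simp [h1, h2] at h
  smul_mem' := by
    intro r W hW c b h
    refine hW c b fun h0 => h ?_
    rw [coeff_smul, coeff_smul, h0, smul_zero]

instance : SetLike.GradedMonoid (mvGrading σ L) where
  one_mem := by
    classical
    intro c b h
    rw [coeff_one] at h
    split_ifs at h with hc
    · rw [coeff_one] at h
      split_ifs at h with hb
      · simp [← hc, ← hb]
      · simp at h
    · simp at h
  mul_mem := by
    classical
    intro j k V W hV hW c b h
    rw [coeff_mul, coeff_sum] at h
    obtain ⟨x, hx, hxn⟩ := Finset.exists_ne_zero_of_sum_ne_zero h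
    rw [coeff_mul] at hxn
    obtain ⟨y, hy, hyn⟩ := Finset.exists_ne_zero_of_sum_ne_zero hxn
    have h1 := hV _ _ (left_ne_zero_of_mul hyn)
    have h2 := hW _ _ (right_ne_zero_of_mul hyn)
    rw [Finset.HasAntidiagonal.mem_antidiagonal] at hx hy
    rw [← hx, ← hy, map_add, map_add]
    omega

/-- Bivariate polynomials that are homogeneous of total degree `k`. -/
def bivariateGrading (L : Type*) [Field L] (k : ℕ) : Submodule L (Polynomial (Polynomial L)) where
  carrier := {W | ∀ i j, (W.coeff i).coeff j ≠ 0 → i + j = k}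
  zero_mem' := by simp
  add_mem' := by
    intro V W hV hW c b h
    by_contra hne
    have h1 : (V.coeff c).coeff b = 0 := by by_contra h'; exact hne (hV c b h')
    have h2 : (W.coeff c).coeff b = 0 := by by_contra h'; exact hne (hW c b h')
    simp [h1, h2] at h
  smul_mem' := by
    intro r W hW c b h
    refine hW c b fun h0 => h ?_
    rw [Polynomial.coeff_smul, Polynomial.coeff_smul, h0, smul_zero]

instance : SetLike.GradedMonoid (bivariateGrading L) where
  one_mem := by
    intro c b h
    rw [Polynomial.coeff_one] at h
    split_ifs at h with hc
    · rw [Polynomial.coeff_one] at h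
      split_ifs at h with hb
      · omega
      · simp at h
    · simp at h
  mul_mem := by
    intro j k V W hV hW c b h
    rw [Polynomial.coeff_mul, Polynomial.finsetSum_coeff] at h
    obtain ⟨x, hx, hxn⟩ := Finset.exists_ne_zero_of_sum_ne_zero h
    rw [Polynomial.coeff_mul] at hxn
    obtain ⟨y, hy, hyn⟩ := Finset.exists_ne_zero_of_sum_ne_zero hxn
    have h1 := hV _ _ (left_ne_zero_of_mul hyn)
    have h2 := hW _ _ (right_ne_zero_of_mul hyn)
    rw [Finset.HasAntidiagonal.mem_antidiagonal] at hx hy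
    omega

end Graded

section Hasse

variable {σ L : Type*} [Field L]

/-- The substitution `x ↦ x + p`. -/
noncomputable def translate (p : σ → L) : MvPolynomial σ L →ₐ[L] MvPolynomial σ L :=
  aeval fun i => X i + C (p i)

/-- The polynomial `P(x + z)`, as a polynomial in `z` with coefficients that are polynomials
in `x`. -/
noncomputable def taylorExpansion (σ L : Type*) [Field L] :
    MvPolynomial σ L →ₐ[L] MvPolynomial σ (MvPolynomial σ L) :=
  aeval fun i => X i + C (X i)

/-- The Hasse derivative of multi-index `c`. -/
noncomputable def hasse (c : σ →₀ ℕ) : MvPolynomial σ L →ₗ[L] MvPolynomial σ L :=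
  ((lcoeff (MvPolynomial σ L) c).restrictScalars L).comp (taylorExpansion σ L).toLinearMap

theorem hasse_apply (c : σ →₀ ℕ) (P : MvPolynomial σ L) :
    hasse c P = coeff c (taylorExpansion σ L P) := rfl

theorem coeff_translate (p : σ → L) (c : σ →₀ ℕ) (P : MvPolynomial σ L) :
    coeff c (translate p P) = eval p (hasse c P) := by
  rw [hasse_apply, ← coeff_map]
  congr 1
  have : translate p = (mapAlgHom (σ := σ) (aeval p : MvPolynomial σ L →ₐ[L] L)).comp
      (taylorExpansion σ L) := by
    ext i : 1
    simp [translate, taylorExpansion]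
  rw [this]
  rfl

theorem translate_zero (P : MvPolynomial σ L) : translate 0 P = P := by
  have : translate (0 : σ → L) = AlgHom.id L _ := by
    ext i : 1
    simp [translate]
  rw [this]; rfl

theorem hasse_translate (p : σ → L) (c : σ →₀ ℕ) (P : MvPolynomial σ L) :
    hasse c (translate p P) = translate p (hasse c P) := by
  have : (taylorExpansion σ L).comp (translate p) =
      (mapAlgHom (σ := σ) (translate p)).comp (taylorExpansion σ L) := by
    ext i : 1
    simp [translate, taylorExpansion, add_assoc]
  have h := congrArg (coeff c) (DFunLike.congr_fun this P)
  rw [hasse_apply, hasse_apply]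
  refine h.trans ?_
  exact coeff_map (translate p : MvPolynomial σ L →+* MvPolynomial σ L) _ c

theorem coeff_hasse_eq_zero {P : MvPolynomial σ L} {k : ℕ} (hP : P.IsHomogeneous k)
    {b c : σ →₀ ℕ} (h : b.degree + c.degree ≠ k) : coeff b (hasse c P) = 0 := by
  classical
  have := aeval_mem_of_isHomogeneous (mvGrading σ L) (f := fun i => X i + C (X i)) (fun i => ?_) hP
  · by_contra hne
    exact h (this c b hne)
  · refine Submodule.add_mem _ ?_ ?_
    · intro c b hne
      rw [coeff_X] at hne
      split_ifs at hne with hc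
      · rw [coeff_one] at hne
        split_ifs at hne with hb
        · simp [← hc, ← hb]
        · simp at hne
      · simp at hne
    · intro c b hne
      rw [coeff_C] at hne
      split_ifs at hne with hc
      · rw [coeff_X] at hne
        split_ifs at hne with hb
        · simp [← hc, ← hb]
        · simp at hne
      · simp at hne

theorem coeff_hasse (b c : σ →₀ ℕ) (P : MvPolynomial σ L) :
    coeff b (hasse c P) =
      coeff b (hasse c (homogeneousComponent (b.degree + c.degree) P)) := by
  by_cases hd : b.degree + c.degree ∈ Finset.range (P.totalDegree + 1)
  · conv_lhs => rw [← sum_homogeneousComponent P, map_sum, coeff_sum]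
    refine Finset.sum_eq_single_of_mem _ hd fun k _ hk => ?_
    exact coeff_hasse_eq_zero (homogeneousComponent_isHomogeneous k P) hk.symm
  · rw [homogeneousComponent_eq_zero _ _ (by simpa using hd), map_zero]
    conv_lhs => rw [← sum_homogeneousComponent P, map_sum, coeff_sum]
    refine Finset.sum_eq_zero fun k hk => ?_
    refine coeff_hasse_eq_zero (homogeneousComponent_isHomogeneous k P) fun h => hd (h ▸ hk)

theorem coeff_hasse_eq_zero_of_totalDegree_lt {P : MvPolynomial σ L} {b c : σ →₀ ℕ}
    (h : P.totalDegree < b.degree + c.degree) : coeff b (hasse c P) = 0 := by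
  rw [coeff_hasse, homogeneousComponent_eq_zero _ _ h, map_zero, coeff_zero]

theorem homogeneousComponent_hasse (j : ℕ) (c : σ →₀ ℕ) (P : MvPolynomial σ L) :
    homogeneousComponent j (hasse c P) = hasse c (homogeneousComponent (j + c.degree) P) := by
  classical
  ext b
  rw [coeff_homogeneousComponent]
  split_ifs with h
  · rw [coeff_hasse, h]
  · exact (coeff_hasse_eq_zero (homogeneousComponent_isHomogeneous _ P) (by omega)).symm

theorem totalDegree_le_iff {P : MvPolynomial σ L} {d : ℕ} :
    P.totalDegree ≤ d ↔ ∀ b : σ →₀ ℕ, d < b.degree → coeff b P = 0 := by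
  constructor
  · intro h b hb
    by_contra hne
    have := le_totalDegree (mem_support_iff.2 hne)
    change b.degree ≤ _ at this
    omega
  · intro h
    rw [totalDegree, Finset.sup_le_iff]
    intro b hb
    change b.degree ≤ _
    by_contra hlt
    exact mem_support_iff.1 hb (h b (by omega))

theorem totalDegree_hasse_le {P : MvPolynomial σ L} {d : ℕ} (c : σ →₀ ℕ) (h : P.totalDegree ≤ d) :
    (hasse c P).totalDegree ≤ d - c.degree :=
  totalDegree_le_iff.2 fun b hb => coeff_hasse_eq_zero_of_totalDegree_lt (by omega)

theorem coeff_translate_of_totalDegree_le {P : MvPolynomial σ L} {p : σ → L} {c : σ →₀ ℕ}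
    (h : P.totalDegree ≤ c.degree) : coeff c (translate p P) = coeff c P := by
  have hC : hasse c P = C (coeff 0 (hasse c P)) := by
    rw [← totalDegree_eq_zero_iff_eq_C]
    have := totalDegree_hasse_le c h
    omega
  have h0 : coeff c P = eval 0 (hasse c P) := by
    conv_lhs => rw [← translate_zero P]
    rw [coeff_translate]
  rw [coeff_translate, h0, hC, eval_C, eval_C]

theorem totalDegree_translate_le {P : MvPolynomial σ L} {d : ℕ} (p : σ → L)
    (h : P.totalDegree ≤ d) : (translate p P).totalDegree ≤ d :=
  totalDegree_le_iff.2 fun b hb => by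
    rw [coeff_translate_of_totalDegree_le (h.trans hb.le)]
    exact totalDegree_le_iff.1 h b hb

/-- `P` vanishes at `p` to order at least `m`. -/
def VanishesToOrder (m : ℕ) (P : MvPolynomial σ L) (p : σ → L) : Prop :=
  ∀ c : σ →₀ ℕ, c.degree < m → coeff c (translate p P) = 0

theorem VanishesToOrder.hasse {m : ℕ} {P : MvPolynomial σ L} {p : σ → L}
    (h : VanishesToOrder m P p) (c : σ →₀ ℕ) :
    VanishesToOrder (m - c.degree) (hasse c P) p := by
  classical
  intro b hb
  rw [← hasse_translate, coeff_hasse]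
  have : homogeneousComponent (b.degree + c.degree) (translate p P) = 0 := by
    ext e
    rw [coeff_homogeneousComponent]
    split_ifs with he
    · exact h e (by omega)
    · rfl
  rw [this, map_zero, coeff_zero]

end Hasse

end Furstenberg

namespace Furstenberg

section Bivariate

open Polynomial

/-- Translation of a bivariate polynomial by `(s, t)`. -/
noncomputable def bivariateShift {L : Type*} [Field L] (s t : L) : L[X][X] →ₐ[L] L[X][X] :=
  (Polynomial.mapAlgHom (Polynomial.taylorAlgHom t)).comp
    ((Polynomial.taylorAlgHom (C s : L[X])).restrictScalars L)

theorem coeff_bivariateShift {L : Type*} [Field L] (s t : L) (R : L[X][X]) (i : ℕ) :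
    (bivariateShift s t R).coeff i = taylor t ((taylor (C s) R).coeff i) := by
  change (Polynomial.map (taylorAlgHom t : L[X] →+* L[X]) (taylor (C s) R)).coeff i = _
  rw [Polynomial.coeff_map]
  rfl

/-- The coefficient of `t ^ D` of a bivariate polynomial, as a polynomial in the outer variable. -/
noncomputable def innerCoeff {L : Type*} [Field L] (D : ℕ) : L[X][X] →ₗ[L] L[X] where
  toFun R := R.sum fun i a => monomial i (a.coeff D)
  map_add' R S := Polynomial.sum_add_index _ _ _ (by simp) (by simp)
  map_smul' r R := by
    rw [Polynomial.sum_smul_index' _ _ _ (by simp)]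
    simp [Polynomial.sum_def, Finset.mul_sum, Polynomial.smul_eq_C_mul, Polynomial.C_mul_monomial]

theorem coeff_innerCoeff {L : Type*} [Field L] (D : ℕ) (R : L[X][X]) (i : ℕ) :
    (innerCoeff D R).coeff i = (R.coeff i).coeff D := by
  change (R.sum fun i a => monomial i (a.coeff D)).coeff i = _
  rw [Polynomial.sum_def, Polynomial.finsetSum_coeff]
  simp only [Polynomial.coeff_monomial, Finset.sum_ite_eq']
  split_ifs with h
  · rfl
  · rw [Polynomial.notMem_support_iff.1 h, Polynomial.coeff_zero]

theorem innerCoeff_taylor {L : Type*} [Field L] (D : ℕ) (R : L[X][X]) (s : L) :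
    innerCoeff D (taylor (C s) R) = taylor s (innerCoeff D R) := by
  induction R using Polynomial.induction_on' with
  | add p q hp hq => simp only [map_add, hp, hq]
  | monomial n a =>
    have h1 : innerCoeff D (monomial n a) = monomial n (a.coeff D) := by
      ext i
      rw [coeff_innerCoeff, Polynomial.coeff_monomial, Polynomial.coeff_monomial]
      split_ifs <;> simp
    ext i
    rw [coeff_innerCoeff, h1, taylor_monomial, taylor_monomial]
    rw [Polynomial.coeff_C_mul, Polynomial.coeff_C_mul, Polynomial.coeff_X_add_C_pow,
      Polynomial.coeff_X_add_C_pow, ← C_pow, ← mul_assoc]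
    rw [← Polynomial.C_eq_natCast, Polynomial.coeff_mul_C, Polynomial.coeff_mul_C, mul_assoc]

/-- The Schwartz-Zippel lemma with multiplicities, in two variables. -/
theorem card_mul_le_of_vanishing {L : Type*} [Field L] [DecidableEq L] {R : L[X][X]} (hR : R ≠ 0)
    {d M : ℕ} (hd : ∀ i j, (R.coeff i).coeff j ≠ 0 → i + j ≤ d) (S : Finset L)
    (E : Finset (L × L)) (hE : E ⊆ S ×ˢ S)
    (hv : ∀ x ∈ E, ∀ i j, i + j < M → ((bivariateShift x.1 x.2 R).coeff i).coeff j = 0) :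
    E.card * M ≤ S.card * d := by
  classical
  -- `D` is the degree in the inner variable
  have hex : ∃ D, innerCoeff D R ≠ 0 ∧ ∀ D', D < D' → innerCoeff D' R = 0 := by
    have hfin : ∃ D, innerCoeff D R ≠ 0 := by
      by_contra! h
      refine hR ?_
      ext i j
      rw [← coeff_innerCoeff, h j]
      simp
    have hb : ∀ D, innerCoeff D R ≠ 0 → D ≤ d := by
      intro D h
      obtain ⟨i, hi⟩ : ∃ i, (innerCoeff D R).coeff i ≠ 0 := by
        by_contra! h'
        exact h (by ext i; simp [h' i])
      rw [coeff_innerCoeff] at hi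
      have := hd _ _ hi
      omega
    refine ⟨Nat.findGreatest (fun D => innerCoeff D R ≠ 0) d, ?_, ?_⟩
    · obtain ⟨D, hD⟩ := hfin
      exact Nat.findGreatest_spec (P := fun D => innerCoeff D R ≠ 0) (hb D hD) hD
    · intro D' hD'
      by_contra hne
      exact absurd (Nat.le_findGreatest (P := fun D => innerCoeff D R ≠ 0) (hb D' hne) hne)
        (by omega)
  obtain ⟨D, hD, hmax⟩ := hex
  set g := innerCoeff D R with hg
  have hgdeg : D + g.natDegree ≤ d := by
    have : g.coeff g.natDegree ≠ 0 := by simpa using hD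
    rw [hg, coeff_innerCoeff, ← hg] at this
    have := hd _ _ this
    omega
  have hline : ∀ s : L, (E.filter fun x => x.1 = s).card * M ≤
      D + (E.filter fun x => x.1 = s).card * g.rootMultiplicity s := by
    intro s
    set μ := g.rootMultiplicity s with hμ
    set r := (taylor (C s) R).coeff μ with hr
    have hrD : r.coeff D ≠ 0 := by
      rw [hr, ← coeff_innerCoeff, innerCoeff_taylor, ← hg]
      rw [hμ, rootMultiplicity_eq_natTrailingDegree, ← taylor_apply]
      have : taylor s g ≠ 0 := by simpa using hD
      exact Polynomial.trailingCoeff_nonzero_iff_nonzero.2 this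
    have hr0 : r ≠ 0 := fun h => hrD (by rw [h, Polynomial.coeff_zero])
    have hdeg : r.natDegree ≤ D := by
      rw [Polynomial.natDegree_le_iff_coeff_eq_zero]
      intro D' hD'
      rw [hr, ← coeff_innerCoeff, innerCoeff_taylor, hmax D' hD']
      simp
    have hmult : ∀ x ∈ E.filter (fun x => x.1 = s), M - μ ≤ r.rootMultiplicity x.2 := by
      intro x hx
      obtain ⟨hxE, rfl⟩ := Finset.mem_filter.1 hx
      rw [rootMultiplicity_eq_natTrailingDegree, ← taylor_apply]
      refine Polynomial.le_natTrailingDegree (by simpa using hr0) fun j hj => ?_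
      rw [hr, ← coeff_bivariateShift]
      exact hv x hxE _ _ (by omega)
    have hinj : Set.InjOn Prod.snd (E.filter (fun x => x.1 = s) : Set (L × L)) := by
      intro x hx y hy hxy
      rw [Finset.mem_coe, Finset.mem_filter] at hx hy
      exact Prod.ext (hx.2.trans hy.2.symm) hxy
    have hsum : (E.filter fun x => x.1 = s).card * (M - μ) ≤ D := by
      calc (E.filter fun x => x.1 = s).card * (M - μ)
          ≤ ∑ x ∈ E.filter (fun x => x.1 = s), r.rootMultiplicity x.2 := by
            rw [← smul_eq_mul]; exact Finset.card_nsmul_le_sum _ _ _ hmult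
        _ = ∑ t ∈ (E.filter (fun x => x.1 = s)).image Prod.snd, r.roots.count t := by
            rw [Finset.sum_image hinj]
            simp
        _ ≤ r.roots.card := by
            rw [← Multiset.toFinset_sum_count_eq r.roots]
            refine (Finset.sum_le_sum_of_ne_zero fun t _ ht => ?_)
            rw [Multiset.mem_toFinset]
            exact Multiset.count_ne_zero.1 ht
        _ ≤ D := (Polynomial.card_roots' r).trans hdeg
    calc _ ≤ (E.filter fun x => x.1 = s).card * ((M - μ) + μ) :=
          Nat.mul_le_mul_left _ (by omega)
      _ ≤ _ := by rw [mul_add]; omega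
  have hcard : ∀ s : L, (E.filter fun x => x.1 = s).card ≤ S.card := by
    intro s
    refine Finset.card_le_card_of_injOn Prod.snd (fun x hx => ?_) fun x hx y hy hxy => ?_
    · exact (Finset.mem_product.1 (hE (Finset.mem_filter.1 hx).1)).2
    · exact Prod.ext ((Finset.mem_filter.1 hx).2.trans (Finset.mem_filter.1 hy).2.symm) hxy
  have hfib : E.card = ∑ s ∈ S, (E.filter fun x => x.1 = s).card :=
    Finset.card_eq_sum_card_fiberwise fun x hx => (Finset.mem_product.1 (hE hx)).1
  calc E.card * M = ∑ s ∈ S, (E.filter fun x => x.1 = s).card * M := by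
        rw [hfib, Finset.sum_mul]
    _ ≤ ∑ s ∈ S, (D + S.card * g.rootMultiplicity s) :=
        Finset.sum_le_sum fun s _ =>
          (hline s).trans (Nat.add_le_add_left (Nat.mul_le_mul_right _ (hcard s)) _)
    _ = S.card * (D + ∑ s ∈ S, g.roots.count s) := by
        simp [Finset.sum_add_distrib, Finset.mul_sum, mul_add]
    _ ≤ S.card * d := by
        refine Nat.mul_le_mul_left _ (le_trans (Nat.add_le_add_left ?_ _) hgdeg)
        refine le_trans ?_ (Polynomial.card_roots' g)
        rw [← Multiset.toFinset_sum_count_eq g.roots]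
        refine Finset.sum_le_sum_of_ne_zero fun t _ ht => ?_
        rw [Multiset.mem_toFinset]
        exact Multiset.count_ne_zero.1 ht

end Bivariate

section Plane

open MvPolynomial

variable {σ L : Type*} [Field L]

/-- Restriction of a polynomial to the plane spanned by `u` and `v`. -/
noncomputable def planeRestrict (u v : σ → L) :
    MvPolynomial σ L →ₐ[L] Polynomial (Polynomial L) :=
  aeval fun i => Polynomial.C (Polynomial.C (u i)) * Polynomial.X +
    Polynomial.C (Polynomial.C (v i) * Polynomial.X)

theorem bivariateShift_planeRestrict (u v p : σ → L) (s t : L) (P : MvPolynomial σ L) :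
    bivariateShift s t (planeRestrict u v (translate p P)) =
      planeRestrict u v (translate (p + s • u + t • v) P) := by
  have : ((bivariateShift s t).comp (planeRestrict u v)).comp (translate p) =
      (planeRestrict u v).comp (translate (p + s • u + t • v)) := by
    ext i : 1
    have hC : ∀ r : L, bivariateShift s t (Polynomial.C (Polynomial.C r)) =
        Polynomial.C (Polynomial.C r) := fun r => (bivariateShift s t).commutes r
    have hX : bivariateShift s t Polynomial.X =
        Polynomial.X + Polynomial.C (Polynomial.C s) := by
      simp [bivariateShift]
    have hY : bivariateShift s t (Polynomial.C Polynomial.X) =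
        Polynomial.C (Polynomial.X + Polynomial.C t) := by
      simp [bivariateShift]
    have hA : ∀ r : L, algebraMap L (Polynomial (Polynomial L)) r =
        Polynomial.C (Polynomial.C r) := fun r => rfl
    simp [translate, planeRestrict, hC, hX, hY, hA]
    ring
  exact DFunLike.congr_fun this P

theorem coeff_planeRestrict_eq_zero (u v : σ → L) {P : MvPolynomial σ L} {k i j : ℕ}
    (hP : P.IsHomogeneous k) (h : i + j ≠ k) : ((planeRestrict u v P).coeff i).coeff j = 0 := by
  by_contra hne
  refine h (aeval_mem_of_isHomogeneous (bivariateGrading L) (fun l => ?_) hP i j hne)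
  intro i j hij
  rw [Polynomial.coeff_add, Polynomial.coeff_C_mul, Polynomial.coeff_X, Polynomial.coeff_C,
    Polynomial.coeff_add] at hij
  by_contra h1
  refine hij ?_
  rw [Polynomial.coeff_C_mul]
  by_cases h2 : i = 0
  · subst h2
    have h3 : j ≠ 1 := by omega
    simp [Polynomial.coeff_X, h3.symm]
  · by_cases h3 : i = 1
    · subst h3
      have h4 : j ≠ 0 := by omega
      simp [Polynomial.coeff_one, h4]
    · simp [h2, Ne.symm h3]

theorem coeff_planeRestrict (u v : σ → L) (P : MvPolynomial σ L) (i j : ℕ) :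
    ((planeRestrict u v P).coeff i).coeff j =
      ((planeRestrict u v (homogeneousComponent (i + j) P)).coeff i).coeff j := by
  by_cases hd : i + j ∈ Finset.range (P.totalDegree + 1)
  · conv_lhs => rw [← sum_homogeneousComponent P, map_sum, Polynomial.finsetSum_coeff,
      Polynomial.finsetSum_coeff]
    refine Finset.sum_eq_single_of_mem _ hd fun k _ hk => ?_
    exact coeff_planeRestrict_eq_zero u v (homogeneousComponent_isHomogeneous k P) hk.symm
  · rw [homogeneousComponent_eq_zero _ _ (by simpa using hd), map_zero]
    conv_lhs => rw [← sum_homogeneousComponent P, map_sum, Polynomial.finsetSum_coeff,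
      Polynomial.finsetSum_coeff]
    refine Finset.sum_eq_zero fun k hk => ?_
    exact coeff_planeRestrict_eq_zero u v (homogeneousComponent_isHomogeneous k P)
      fun h => hd (h ▸ hk)

theorem eval_planeRestrict (u v : σ → L) (P : MvPolynomial σ L) (s t : L) :
    ((planeRestrict u v P).eval (Polynomial.C s)).eval t = eval (s • u + t • v) P := by
  have : ((Polynomial.aeval t : Polynomial L →ₐ[L] L).comp
      ((Polynomial.aeval (Polynomial.C s : Polynomial L) :
        Polynomial (Polynomial L) →ₐ[Polynomial L] Polynomial L).restrictScalars L)).comp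
      (planeRestrict u v) = (aeval (s • u + t • v) : MvPolynomial σ L →ₐ[L] L) := by
    ext i : 1
    simp only [planeRestrict, AlgHom.comp_apply, aeval_X]
    simp
    ring
  have h := DFunLike.congr_fun this P
  simpa [Polynomial.aeval_def, Polynomial.eval₂_eq_eval_map] using h

/-- If a polynomial of degree at most `d` vanishes identically on a plane, then its component of
degree `d` vanishes on the direction of the plane. -/
theorem eval_homogeneousComponent_eq_zero {P : MvPolynomial σ L} {d : ℕ} (hP : P.totalDegree ≤ d)
    {u v p : σ → L} (h : planeRestrict u v (translate p P) = 0) (s t : L) :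
    eval (s • u + t • v) (homogeneousComponent d P) = 0 := by
  classical
  rw [← eval_planeRestrict]
  have : planeRestrict u v (homogeneousComponent d P) = 0 := by
    have hc : homogeneousComponent d P = homogeneousComponent d (translate p P) := by
      ext c
      rw [coeff_homogeneousComponent, coeff_homogeneousComponent]
      split_ifs with hc
      · rw [coeff_translate_of_totalDegree_le (hc ▸ hP)]
      · rfl
    ext i j
    by_cases hij : i + j = d
    · rw [hc, ← hij, ← coeff_planeRestrict, h]
    · rw [coeff_planeRestrict_eq_zero u v (homogeneousComponent_isHomogeneous d P) hij]
      simp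
  rw [this]
  simp

/-- If `P` has degree at most `d` and vanishes to high order at many points of a plane, then the
component of `P` of degree `d` vanishes to order `l` on the direction of the plane. -/
theorem vanishesToOrder_homogeneousComponent [DecidableEq L] {P : MvPolynomial σ L} {d m l : ℕ}
    (hP : P.totalDegree ≤ d) {u v p : σ → L} (S : Finset L) (E : Finset (L × L))
    (hE : E ⊆ S ×ˢ S) (hv : ∀ x ∈ E, VanishesToOrder m P (p + x.1 • u + x.2 • v))
    (hlt : S.card * d < E.card * (m - l)) (s t : L) :
    VanishesToOrder l (homogeneousComponent d P) (s • u + t • v) := by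
  intro c hc
  rw [coeff_translate]
  by_cases hcd : c.degree ≤ d
  · have hdeg := totalDegree_hasse_le c hP
    have hcomp : hasse c (homogeneousComponent d P) =
        homogeneousComponent (d - c.degree) (hasse c P) := by
      rw [homogeneousComponent_hasse, Nat.sub_add_cancel hcd]
    rw [hcomp]
    have hz : planeRestrict u v (translate p (hasse c P)) = 0 := by
      by_contra hne
      refine absurd (card_mul_le_of_vanishing hne (d := d) (M := m - l) ?_ S E hE ?_) (by omega)
      · intro i j hij
        rw [coeff_planeRestrict] at hij
        by_contra hgt
        refine hij ?_
        rw [homogeneousComponent_eq_zero _ _ ?_, map_zero]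
        · simp
        · have := totalDegree_translate_le p hdeg
          omega
      · intro x hx i j hij
        rw [bivariateShift_planeRestrict, coeff_planeRestrict]
        have : homogeneousComponent (i + j)
            (translate (p + x.1 • u + x.2 • v) (hasse c P)) = 0 := by
          ext b
          rw [coeff_homogeneousComponent]
          split_ifs with hb
          · exact (hv x hx).hasse c b (by omega)
          · rfl
        rw [this, map_zero]
        simp
    exact eval_homogeneousComponent_eq_zero hdeg hz s t
  · have : hasse c (homogeneousComponent d P) = 0 := by
      ext b
      exact coeff_hasse_eq_zero (homogeneousComponent_isHomogeneous d P) (by omega)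
    rw [this, map_zero]

end Plane

open MvPolynomial

section Simplex

/-- The multi-indices of degree less than `m`. -/
def simplex (n m : ℕ) : Finset (Fin n →₀ ℕ) :=
  (Finset.range m).biUnion fun k => Finset.finsuppAntidiag Finset.univ k

theorem mem_simplex {n m : ℕ} {c : Fin n →₀ ℕ} : c ∈ simplex n m ↔ c.degree < m := by
  simp [simplex, Finset.mem_finsuppAntidiag, Finsupp.degree_eq_sum]

theorem card_simplex_succ (n m : ℕ) : (simplex n (m + 1)).card = (n + 1).multichoose m := by
  have h : ∀ m, ∑ k ∈ Finset.range (m + 1), n.multichoose k = (n + 1).multichoose m := by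
    intro m
    induction m with
    | zero => simp
    | succ m ih => rw [Finset.sum_range_succ, ih, Nat.multichoose_succ_succ, add_comm]
  rw [← h, simplex, Finset.card_biUnion]
  · simp [Finset.card_finsuppAntidiag_nat_eq_multichoose]
  · intro i _ j _ hij
    refine Finset.disjoint_left.2 fun c hi hj => ?_
    rw [Finset.mem_finsuppAntidiag] at hi hj
    exact hij (hi.1.symm.trans hj.1)

theorem factorial_mul_card_simplex_succ (n m : ℕ) :
    n.factorial * (simplex n (m + 1)).card = (m + 1).ascFactorial n := by
  rw [card_simplex_succ, Nat.ascFactorial_eq_factorial_mul_choose, Nat.multichoose_eq,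
    ← Nat.choose_symm_add]
  congr 2
  omega

theorem pow_le_factorial_mul_card_simplex {n : ℕ} (hn : n ≠ 0) (m : ℕ) :
    m ^ n ≤ n.factorial * (simplex n m).card := by
  cases m with
  | zero => simp [hn]
  | succ m =>
    rw [factorial_mul_card_simplex_succ]
    exact Nat.pow_succ_le_ascFactorial _ _

theorem factorial_mul_card_simplex_le (n m : ℕ) :
    n.factorial * (simplex n m).card ≤ (m + n) ^ n := by
  cases m with
  | zero => simp [simplex]
  | succ m =>
    rw [factorial_mul_card_simplex_succ]
    exact (Nat.ascFactorial_le_pow_add _ _).trans (Nat.pow_le_pow_left (by omega) _)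

end Simplex

section Dimension

variable {σ L : Type*} [Field L]

theorem totalDegree_le_of_homogeneousComponent_eq_zero {P : MvPolynomial σ L} {d : ℕ}
    (hP : P.totalDegree ≤ d + 1) (h0 : homogeneousComponent (d + 1) P = 0) :
    P.totalDegree ≤ d := by
  classical
  refine totalDegree_le_iff.2 fun b hb => ?_
  rcases eq_or_ne b.degree (d + 1) with h | h
  · have := congrArg (coeff b) h0
    rwa [coeff_homogeneousComponent, if_pos h] at this
  · exact totalDegree_le_iff.1 hP b (by omega)

/-- If the leading forms of the elements of `I` lie in `J`, then `I` is at most as large as `J`. -/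
theorem finrank_le_of_leadingForms [Finite σ] (I J : Submodule L (MvPolynomial σ L)) (D : ℕ)
    (h : ∀ d ≤ D, ∀ P ∈ I, P.totalDegree ≤ d → homogeneousComponent d P ∈ J) :
    Module.finrank L ↥(I ⊓ restrictTotalDegree σ L D) ≤
      Module.finrank L ↥(J ⊓ restrictTotalDegree σ L D) := by
  classical
  have hfin : ∀ (K : Submodule L (MvPolynomial σ L)) (d : ℕ),
      Module.Finite L ↥(K ⊓ restrictTotalDegree σ L d) :=
    fun K d => Submodule.finiteDimensional_of_le inf_le_right
  induction D with
  | zero =>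
    have := hfin J 0
    refine Submodule.finrank_mono fun P hP => ⟨?_, hP.2⟩
    have h0 := (mem_restrictTotalDegree _ _ _).1 hP.2
    have h1 := h 0 le_rfl P hP.1 h0
    rwa [homogeneousComponent_zero, ← totalDegree_eq_zero_iff_eq_C.1 (by omega)] at h1
  | succ D ih =>
    specialize ih fun d hd => h d (by omega)
    have := hfin I (D + 1)
    have := hfin J (D + 1)
    have := hfin I D
    have := hfin J D
    set f := (homogeneousComponent (D + 1) :
      MvPolynomial σ L →ₗ[L] MvPolynomial σ L).domRestrict (I ⊓ restrictTotalDegree σ L (D + 1))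
      with hf
    have h1 := f.finrank_range_add_finrank_ker
    have h2 : Module.finrank L (LinearMap.ker f) ≤
        Module.finrank L ↥(I ⊓ restrictTotalDegree σ L D) := by
      rw [← Submodule.finrank_map_subtype_eq]
      refine Submodule.finrank_mono ?_
      rintro _ ⟨⟨P, hP⟩, hk, rfl⟩
      exact ⟨hP.1, (mem_restrictTotalDegree _ _ _).2
        (totalDegree_le_of_homogeneousComponent_eq_zero ((mem_restrictTotalDegree _ _ _).1 hP.2) hk)⟩
    have hle : LinearMap.range f ⊔ (J ⊓ restrictTotalDegree σ L D) ≤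
        J ⊓ restrictTotalDegree σ L (D + 1) := by
      refine sup_le ?_ ?_
      · rintro _ ⟨⟨P, hP⟩, rfl⟩
        refine ⟨h (D + 1) le_rfl P hP.1 ((mem_restrictTotalDegree _ _ _).1 hP.2), ?_⟩
        exact (mem_restrictTotalDegree _ _ _).2 (homogeneousComponent_isHomogeneous _ P).totalDegree_le
      · intro P hP
        refine ⟨hP.1, (mem_restrictTotalDegree _ _ _).2 ?_⟩
        exact ((mem_restrictTotalDegree _ _ _).1 hP.2).trans (by omega)
    have hdisj : LinearMap.range f ⊓ (J ⊓ restrictTotalDegree σ L D) = ⊥ := by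
      rw [eq_bot_iff]
      rintro _ ⟨⟨⟨P, hP⟩, rfl⟩, h3⟩
      rw [Submodule.mem_bot]
      have h4 := (mem_restrictTotalDegree _ _ _).1 h3.2
      have h5 : (homogeneousComponent (D + 1) P).IsHomogeneous (D + 1) :=
        homogeneousComponent_isHomogeneous _ P
      by_contra hne
      have := h5.totalDegree hne
      have h6 : (homogeneousComponent (D + 1) P).totalDegree ≤ D := h4
      omega
    have h3 := Submodule.finrank_sup_add_finrank_inf_eq (LinearMap.range f)
      (J ⊓ restrictTotalDegree σ L D)
    rw [hdisj, finrank_bot] at h3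
    have h4 := Submodule.finrank_mono hle
    omega

end Dimension

section Jets

variable {L : Type*} [Field L] {n : ℕ}

/-- The jets of order `m` of a polynomial at the points of `Z`. -/
noncomputable def jets (Z : Finset (Fin n → L)) (m : ℕ) :
    MvPolynomial (Fin n) L →ₗ[L] (Z × simplex n m → L) :=
  LinearMap.pi fun x => (lcoeff L (x.2 : Fin n →₀ ℕ)).comp (translate (x.1 : Fin n → L)).toLinearMap

theorem mem_ker_jets {Z : Finset (Fin n → L)} {m : ℕ} {P : MvPolynomial (Fin n) L} :
    P ∈ LinearMap.ker (jets Z m) ↔ ∀ p ∈ Z, VanishesToOrder m P p := by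
  rw [LinearMap.mem_ker, funext_iff]
  constructor
  · intro h p hp c hc
    exact h (⟨p, hp⟩, ⟨c, mem_simplex.2 hc⟩)
  · rintro h ⟨⟨p, hp⟩, ⟨c, hc⟩⟩
    exact h p hp c (mem_simplex.1 hc)

theorem finrank_range_add_finrank_ker_inf {V W : Type*} [AddCommGroup V] [Module L V]
    [AddCommGroup W] [Module L W] (f : V →ₗ[L] W) (R : Submodule L V) [Module.Finite L R] :
    Module.finrank L ↥(R.map f) + Module.finrank L ↥(LinearMap.ker f ⊓ R) =
      Module.finrank L R := by
  have h := (f.domRestrict R).finrank_range_add_finrank_ker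
  rw [← h]
  congr 1
  · rw [LinearMap.range_domRestrict]
  · rw [← Submodule.finrank_map_subtype_eq, LinearMap.ker_domRestrict]
    rw [Submodule.map_comap_subtype, inf_comm]

theorem finrank_ker_jets_add_ge (Z : Finset (Fin n → L)) (m d : ℕ) :
    Module.finrank L (restrictTotalDegree (Fin n) L d) ≤
      Z.card * (simplex n m).card +
        Module.finrank L ↥(LinearMap.ker (jets Z m) ⊓ restrictTotalDegree (Fin n) L d) := by
  rw [← finrank_range_add_finrank_ker_inf (jets Z m)]
  gcongr
  refine (Submodule.finrank_le _).trans ?_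
  simp

theorem finrank_ker_jets_add_of_surjective (Z : Finset (Fin n → L)) (m d : ℕ)
    (h : (restrictTotalDegree (Fin n) L d).map (jets Z m) = ⊤) :
    Module.finrank L (restrictTotalDegree (Fin n) L d) =
      Z.card * (simplex n m).card +
        Module.finrank L ↥(LinearMap.ker (jets Z m) ⊓ restrictTotalDegree (Fin n) L d) := by
  rw [← finrank_range_add_finrank_ker_inf (jets Z m), h, finrank_top]
  simp

end Jets

section Interpolation

variable {L : Type*} [Field L] [Fintype L] {n : ℕ}

/-- Polynomials of order `|c|` everywhere, whose leading jet is supported at `a`. -/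
noncomputable def jetBasis (a : Fin n → L) (c : Fin n →₀ ℕ) : MvPolynomial (Fin n) L :=
  (∏ i, (X i ^ Fintype.card L - X i) ^ c i) * indicator a

theorem totalDegree_jetBasis_le (a : Fin n → L) (c : Fin n →₀ ℕ) :
    (jetBasis a c).totalDegree ≤ (c.degree + n) * Fintype.card L := by
  have hq : 1 ≤ Fintype.card L := Fintype.card_pos
  rw [add_mul]
  refine (totalDegree_mul _ _).trans (add_le_add ?_ ?_)
  · refine (totalDegree_finsetProd _ _).trans ?_
    rw [Finsupp.degree_eq_sum, Finset.sum_mul]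
    refine Finset.sum_le_sum fun i _ => (totalDegree_pow _ _).trans ?_
    refine Nat.mul_le_mul_left _ ((totalDegree_sub _ _).trans ?_)
    simp [hq]
  · refine (totalDegree_finsetProd _ _).trans ?_
    calc _ ≤ ∑ i : Fin n, Fintype.card L := Finset.sum_le_sum fun i _ => ?_
      _ = _ := by simp
    refine (totalDegree_sub _ _).trans (max_le (by simp) ((totalDegree_pow _ _).trans ?_))
    have : (X i - C (a i) : MvPolynomial (Fin n) L).totalDegree ≤ 1 :=
      (totalDegree_sub _ _).trans (by simp)
    calc _ ≤ (Fintype.card L - 1) * 1 := Nat.mul_le_mul_left _ this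
      _ ≤ _ := by omega

theorem translate_jetBasis (p a : Fin n → L) (c : Fin n →₀ ℕ) :
    ∃ W : MvPolynomial (Fin n) L, translate p (jetBasis a c) = monomial c 1 * W ∧
      coeff 0 W = (-1) ^ c.degree * eval p (indicator a) := by
  have hq : 2 ≤ Fintype.card L := Fintype.one_lt_card
  refine ⟨(∏ i, (X i ^ (Fintype.card L - 1) - 1) ^ c i) * translate p (indicator a), ?_, ?_⟩
  · rw [jetBasis, map_mul, ← mul_assoc]
    congr 1
    rw [monomial_eq, C_1, one_mul, Finsupp.prod_fintype _ _ (by simp), ← Finset.prod_mul_distrib,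
      map_prod]
    refine Finset.prod_congr rfl fun i _ => ?_
    rw [map_pow, ← mul_pow, mul_sub, mul_one, ← pow_succ', Nat.sub_add_cancel (by omega)]
    congr 1
    obtain ⟨r, hr⟩ := CharP.exists L
    have : Fact r.Prime := ⟨CharP.char_is_prime L r⟩
    obtain ⟨k, -, hk⟩ := FiniteField.card L r
    have hfrob : (X i + C (p i) : MvPolynomial (Fin n) L) ^ Fintype.card L =
        X i ^ Fintype.card L + C (p i) := by
      conv_rhs => rw [← FiniteField.pow_card (p i), C_pow]
      rw [hk, add_pow_char_pow]
    simp [translate, hfrob]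
  · have htr : ∀ P : MvPolynomial (Fin n) L, constantCoeff (translate p P) = eval p P := by
      have : (constantCoeff (R := L) (σ := Fin n)).comp (translate p).toRingHom =
          eval p := by
        ext <;> simp [translate]
      exact DFunLike.congr_fun this
    change constantCoeff _ = _
    rw [map_mul, map_prod, htr, Finsupp.degree_eq_sum, ← Finset.prod_pow_eq_pow_sum]
    have h0 : Fintype.card L - 1 ≠ 0 := by omega
    simp [h0]

theorem map_jets_eq_top (Z : Finset (Fin n → L)) (m : ℕ) :
    (restrictTotalDegree (Fin n) L ((m + n) * Fintype.card L)).map (jets Z m) = ⊤ := by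
  classical
  let g : (Z × simplex n m → L) →ₗ[L] MvPolynomial (Fin n) L :=
    Fintype.linearCombination L fun x => jetBasis (x.1 : Fin n → L) (x.2 : Fin n →₀ ℕ)
  have hg : ∀ w, g w ∈ restrictTotalDegree (Fin n) L ((m + n) * Fintype.card L) := by
    intro w
    refine Submodule.sum_mem _ fun x _ => Submodule.smul_mem _ _ ?_
    rw [mem_restrictTotalDegree]
    refine (totalDegree_jetBasis_le _ _).trans (Nat.mul_le_mul_right _ ?_)
    have := mem_simplex.1 x.2.2
    omega
  have hinj : Function.Injective ((jets Z m).comp g) := by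
    rw [← LinearMap.ker_eq_bot, LinearMap.ker_eq_bot']
    intro w hw
    have key : ∀ k, ∀ x : Z × simplex n m, (x.2 : Fin n →₀ ℕ).degree = k → w x = 0 := by
      intro k
      induction k using Nat.strong_induction_on with
      | _ k ih =>
      intro x hx
      have h0 := congrFun hw x
      change coeff (x.2 : Fin n →₀ ℕ) (translate (x.1 : Fin n → L) (g w)) = 0 at h0
      rw [Fintype.linearCombination_apply, map_sum, coeff_sum,
        Finset.sum_eq_single_of_mem x (Finset.mem_univ x)] at h0
      · rw [map_smul, coeff_smul] at h0
        obtain ⟨W, hW, hW0⟩ := translate_jetBasis (x.1 : Fin n → L) x.1 (x.2 : Fin n →₀ ℕ)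
        rw [hW, coeff_monomial_mul', if_pos le_rfl, tsub_self, hW0,
          eval_indicator_apply_eq_one] at h0
        simpa using h0
      · intro y _ hy
        rw [map_smul, coeff_smul]
        by_cases hyk : (y.2 : Fin n →₀ ℕ).degree < k
        · rw [ih _ hyk y rfl, zero_smul]
        · obtain ⟨W, hW, hW0⟩ := translate_jetBasis (x.1 : Fin n → L) y.1 (y.2 : Fin n →₀ ℕ)
          rw [hW, coeff_monomial_mul']
          split_ifs with hle
          · have heq : (y.2 : Fin n →₀ ℕ) = x.2 := by
              obtain ⟨e, he⟩ := exists_add_of_le hle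
              have h1 := congrArg Finsupp.degree he
              rw [map_add] at h1
              have h2 : e.degree = 0 := by omega
              rw [Finsupp.degree_eq_zero_iff] at h2
              rw [he, h2, add_zero]
            have hne : (x.1 : Fin n → L) ≠ y.1 := by
              intro h
              exact hy (Prod.ext (Subtype.ext h.symm) (Subtype.ext heq))
            rw [heq, tsub_self, hW0, eval_indicator_apply_eq_zero _ _ hne]
            simp
          · simp
    ext x
    exact key _ x rfl
  have hsurj := LinearMap.surjective_of_injective hinj
  rw [eq_top_iff]
  intro w _
  obtain ⟨v, rfl⟩ := hsurj w
  exact ⟨g v, hg v, rfl⟩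

end Interpolation

section Counting

variable {F V : Type*} [Field F] [AddCommGroup V] [Module F V]

theorem exists_submodule_ge_finrank_eq [FiniteDimensional F V] (W : Submodule F V) {k : ℕ}
    (hW : Module.finrank F W ≤ k) (hk : k ≤ Module.finrank F V) :
    ∃ A : Submodule F V, W ≤ A ∧ Module.finrank F A = k := by
  induction k, hW using Nat.le_induction with
  | base => exact ⟨W, le_rfl, rfl⟩
  | succ k _ ih =>
    obtain ⟨A, hWA, hA⟩ := ih (by omega)
    have hne : A ≠ ⊤ := by
      rintro rfl
      rw [finrank_top] at hA
      omega
    obtain ⟨x, -, hx⟩ := SetLike.exists_of_lt (lt_top_iff_ne_top.2 hne)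
    refine ⟨A ⊔ F ∙ x, hWA.trans le_sup_left, le_antisymm ?_ ?_⟩
    · refine (Submodule.finrank_add_le_finrank_add_finrank _ _).trans ?_
      have := finrank_span_le_card (R := F) ({x} : Set V)
      simp at this
      omega
    · rw [Nat.succ_le_iff, ← hA]
      refine Submodule.finrank_lt_finrank_of_lt (lt_of_le_of_ne le_sup_left fun h => hx ?_)
      rw [h]
      exact Submodule.mem_sup_right (Submodule.mem_span_singleton_self x)

theorem exists_linearEquiv_map_eq [FiniteDimensional F V] {A B : Submodule F V}
    (h : Module.finrank F A = Module.finrank F B) :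
    ∃ g : V ≃ₗ[F] V, A.map (g : V →ₗ[F] V) = B := by
  let f := LinearEquiv.ofFinrankEq A B h
  obtain ⟨g, hg⟩ := Submodule.exists_linearEquiv_restrict_eq f
  refine ⟨g, le_antisymm ?_ fun y hy => ?_⟩
  · rintro _ ⟨x, hx, rfl⟩
    have := hg ⟨x, hx⟩
    change g x ∈ B
    rw [← this]
    exact (f ⟨x, hx⟩).2
  · refine ⟨f.symm ⟨y, hy⟩, (f.symm ⟨y, hy⟩).2, ?_⟩
    have := hg (f.symm ⟨y, hy⟩)
    change g _ = y
    rw [← this, f.apply_symm_apply]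

/-- The pairs of vectors lying in a common member of a `β`-fraction of the planes form at least a
`β`-fraction of all pairs. -/
theorem mul_card_le_card_pairs [Finite F] [Finite V] (hV : 2 ≤ Module.finrank F V)
    {𝒢 : Set (Submodule F V)} (h2 : ∀ A ∈ 𝒢, Module.finrank F A = 2) {β : ℝ}
    (hβ : β * ({A : Submodule F V | Module.finrank F A = 2}.ncard : ℝ) ≤ (𝒢.ncard : ℝ)) :
    β * (Nat.card (V × V) : ℝ) ≤ ({c : V × V | ∃ A ∈ 𝒢, c.1 ∈ A ∧ c.2 ∈ A}.ncard : ℝ) := by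
  classical
  have : FiniteDimensional F V := Module.Finite.of_finite
  have : Finite (V ≃ₗ[F] V) := DFunLike.finite _
  have := Fintype.ofFinite (V ≃ₗ[F] V)
  have := Fintype.ofFinite V
  have : Fintype (Submodule F V) := Fintype.ofFinite _
  rw [Set.ncard_eq_toFinset_card', Set.ncard_eq_toFinset_card'] at hβ
  rw [Set.ncard_eq_toFinset_card', Nat.card_eq_fintype_card]
  set N := {A : Submodule F V | Module.finrank F A = 2}.toFinset with hN
  set Gd := 𝒢.toFinset with hGd
  set T := {c : V × V | ∃ A ∈ 𝒢, c.1 ∈ A ∧ c.2 ∈ A}.toFinset with hT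
  let f : Submodule F V → ℕ := fun A =>
    (Finset.univ.filter fun g : V ≃ₗ[F] V => A.map (g : V →ₗ[F] V) ∈ Gd).card
  have hfle : ∀ A ∈ N, ∀ B ∈ N, f B ≤ f A := by
    intro A hA B hB
    simp only [hN, Set.mem_toFinset, Set.mem_ofPred_eq] at hA hB
    obtain ⟨h, rfl⟩ := exists_linearEquiv_map_eq (hA.trans hB.symm)
    refine Finset.card_le_card_of_injOn (fun g => h.trans g) (fun g hg => ?_)
      fun g _ g' _ hgg => ?_
    · simp only [Finset.coe_filter, Finset.mem_univ, true_and, Set.mem_ofPred_eq] at hg ⊢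
      rwa [← Submodule.map_comp] at hg
    · ext x
      have := DFunLike.congr_fun hgg (h.symm x)
      simpa using this
  have hsum : Fintype.card (V ≃ₗ[F] V) * Gd.card ≤ ∑ A ∈ N, f A := by
    simp only [f, Finset.card_filter]
    rw [Finset.sum_comm, ← Finset.card_univ, ← smul_eq_mul]
    refine Finset.card_nsmul_le_sum _ _ _ fun g _ => ?_
    rw [← Finset.card_filter]
    have hcancel : ∀ B : Submodule F V,
        (B.map (g.symm : V →ₗ[F] V)).map (g : V →ₗ[F] V) = B := by
      intro B
      rw [← Submodule.map_comp]
      simp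
    refine Finset.card_le_card_of_injOn (fun B => B.map (g.symm : V →ₗ[F] V)) (fun B hB => ?_)
      fun B _ B' _ hBB => ?_
    · simp only [hGd, Set.coe_toFinset] at hB
      simp only [Finset.coe_filter, Set.mem_ofPred_eq, hN, Set.mem_toFinset]
      refine ⟨(LinearEquiv.finrank_map_eq g.symm B).trans (h2 B hB), ?_⟩
      rw [hcancel]
      simpa [hGd] using hB
    · have := congrArg (Submodule.map (g : V →ₗ[F] V)) hBB
      simpa only [hcancel] using this
  have hfmem : ∀ c : V × V, ∃ A ∈ N, c.1 ∈ A ∧ c.2 ∈ A := by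
    intro c
    obtain ⟨A, hcA, hA⟩ := exists_submodule_ge_finrank_eq (Submodule.span F {c.1, c.2}) (k := 2)
      (by
        have := finrank_span_le_card (R := F) ({c.1, c.2} : Set V)
        refine this.trans ?_
        rw [← Set.ncard_eq_toFinset_card']
        exact (Set.ncard_insert_le _ _).trans (by simp)) hV
    refine ⟨A, by simpa [hN] using hA, hcA (Submodule.subset_span (by simp)),
      hcA (Submodule.subset_span (by simp))⟩
  obtain ⟨A₀, hA₀, -⟩ := hfmem 0
  have hT2 : ∀ c : V × V, f A₀ ≤
      (Finset.univ.filter fun g : V ≃ₗ[F] V => (g c.1, g c.2) ∈ T).card := by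
    intro c
    obtain ⟨A, hA, h1, h2'⟩ := hfmem c
    refine (hfle A hA A₀ hA₀).trans (Finset.card_le_card fun g hg => ?_)
    simp only [Finset.mem_filter, Finset.mem_univ, true_and, hGd, hT, Set.mem_toFinset,
      Set.mem_ofPred_eq] at hg ⊢
    exact ⟨_, hg, Submodule.mem_map_of_mem h1, Submodule.mem_map_of_mem h2'⟩
  have hTsum : Fintype.card (V × V) * f A₀ ≤ Fintype.card (V ≃ₗ[F] V) * T.card := by
    calc Fintype.card (V × V) * f A₀ ≤ ∑ c : V × V,
          (Finset.univ.filter fun g : V ≃ₗ[F] V => (g c.1, g c.2) ∈ T).card := by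
          rw [← Finset.card_univ, ← smul_eq_mul]
          exact Finset.card_nsmul_le_sum _ _ _ fun c _ => hT2 c
      _ = ∑ g : V ≃ₗ[F] V, (Finset.univ.filter fun c : V × V => (g c.1, g c.2) ∈ T).card := by
          simp only [Finset.card_filter]
          exact Finset.sum_comm
      _ ≤ ∑ g : V ≃ₗ[F] V, T.card := by
          refine Finset.sum_le_sum fun g _ => ?_
          refine Finset.card_le_card_of_injOn (fun c => (g c.1, g c.2)) (fun c hc => ?_)
            fun c _ c' _ h => ?_
          · simpa using hc
          · simpa [Prod.ext_iff] using h
      _ = _ := by simp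
  have hN0 : 0 < N.card := Finset.card_pos.2 ⟨A₀, hA₀⟩
  have hG0 : 0 < Fintype.card (V ≃ₗ[F] V) := Fintype.card_pos
  have hsum' : Fintype.card (V ≃ₗ[F] V) * Gd.card ≤ N.card * f A₀ := by
    refine hsum.trans ?_
    rw [← smul_eq_mul]
    exact Finset.sum_le_card_nsmul _ _ _ fun A hA => hfle A₀ hA₀ A hA
  have hβf : β * Fintype.card (V ≃ₗ[F] V) ≤ f A₀ := by
    have h1 : (Fintype.card (V ≃ₗ[F] V) : ℝ) * Gd.card ≤ N.card * f A₀ := by exact_mod_cast hsum'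
    have h2 : (0 : ℝ) < N.card := by exact_mod_cast hN0
    refine le_of_mul_le_mul_left ?_ h2
    calc (N.card : ℝ) * (β * Fintype.card (V ≃ₗ[F] V))
        = Fintype.card (V ≃ₗ[F] V) * (β * N.card) := by ring
      _ ≤ Fintype.card (V ≃ₗ[F] V) * Gd.card := by gcongr
      _ ≤ _ := h1
  have h3 : (0 : ℝ) < Fintype.card (V ≃ₗ[F] V) := by exact_mod_cast hG0
  have h4 : (Fintype.card (V × V) : ℝ) * f A₀ ≤ Fintype.card (V ≃ₗ[F] V) * T.card := by
    exact_mod_cast hTsum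
  refine le_of_mul_le_mul_left ?_ h3
  calc (Fintype.card (V ≃ₗ[F] V) : ℝ) * (β * Fintype.card (V × V))
      = Fintype.card (V × V) * (β * Fintype.card (V ≃ₗ[F] V)) := by ring
    _ ≤ Fintype.card (V × V) * f A₀ := by gcongr
    _ ≤ _ := h4

end Counting

section Extension

variable {L : Type*} [Field L] [Fintype L] {n : ℕ}

open MvPolynomial in
theorem card_mul_card_simplex_le [DecidableEq L] (S : Finset L) (Z T : Finset (Fin n → L))
    (l m e : ℕ)
    (hT : ∀ y ∈ T, ∃ (u v p : Fin n → L) (s t : L) (E : Finset (L × L)), E ⊆ S ×ˢ S ∧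
      (∀ x ∈ E, p + x.1 • u + x.2 • v ∈ Z) ∧ e ≤ E.card ∧ y = s • u + t • v)
    (hlt : S.card * ((l + n) * Fintype.card L) < e * (m - l)) :
    T.card * (simplex n l).card ≤ Z.card * (simplex n m).card := by
  set D := (l + n) * Fintype.card L with hD
  have h1 := finrank_ker_jets_add_ge Z m D
  have h2 := finrank_ker_jets_add_of_surjective T l D (map_jets_eq_top T l)
  have h3 := finrank_le_of_leadingForms (LinearMap.ker (jets Z m)) (LinearMap.ker (jets T l)) D
    (by
      intro d hd P hP hdeg
      rw [mem_ker_jets] at hP ⊢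
      intro y hy
      obtain ⟨u, v, p, s, t, E, hES, hEZ, hEe, rfl⟩ := hT y hy
      refine vanishesToOrder_homogeneousComponent hdeg S E hES (fun x hx => hP _ (hEZ x hx)) ?_ s t
      calc S.card * d ≤ S.card * D := Nat.mul_le_mul_left _ hd
        _ < e * (m - l) := hlt
        _ ≤ E.card * (m - l) := Nat.mul_le_mul_right _ hEe)
  omega

/-- A set in `L ^ n` having at least `δ |L|` points on sufficiently many planes is large. -/
theorem card_le_card_mul_pow [DecidableEq L] (hn : n ≠ 0) (S : Finset L) (Z T : Finset (Fin n → L))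
    {δ : ℝ} (hδ : 0 < δ)
    (hT : ∀ y ∈ T, ∃ (u v p : Fin n → L) (s t : L) (E : Finset (L × L)), E ⊆ S ×ˢ S ∧
      (∀ x ∈ E, p + x.1 • u + x.2 • v ∈ Z) ∧ δ * Fintype.card L ≤ E.card ∧ y = s • u + t • v) :
    (T.card : ℝ) ≤ Z.card * (1 + S.card / δ) ^ n := by
  have hL : (0 : ℝ) < Fintype.card L := by exact_mod_cast Fintype.card_pos
  set C : ℝ := S.card * n / δ + 1 + n with hC
  have hbound : ∀ l : ℕ, 0 < l →
      (T.card : ℝ) ≤ Z.card * (1 + S.card / δ + C * (1 / (l : ℝ))) ^ n := by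
    intro l hl
    have hl' : (0 : ℝ) < l := by exact_mod_cast hl
    set r : ℝ := S.card * (l + n) / δ with hr
    have hr0 : 0 ≤ r := by positivity
    set m := l + (⌊r⌋₊ + 1) with hm
    have hlt : S.card * ((l + n) * Fintype.card L) < ⌈δ * Fintype.card L⌉₊ * (m - l) := by
      have h1 : r < ((m - l : ℕ) : ℝ) := by
        rw [hm, Nat.add_sub_cancel_left]
        exact_mod_cast Nat.lt_floor_add_one r
      have h2 : (S.card : ℝ) * ((l + n) * Fintype.card L) <
          (⌈δ * Fintype.card L⌉₊ : ℝ) * ((m - l : ℕ) : ℝ) := by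
        calc (S.card : ℝ) * ((l + n) * Fintype.card L) = (δ * Fintype.card L) * r := by
              rw [hr]; field_simp
          _ < (δ * Fintype.card L) * ((m - l : ℕ) : ℝ) := by gcongr
          _ ≤ _ := by gcongr; exact Nat.le_ceil _
      exact_mod_cast h2
    have hcard := card_mul_card_simplex_le S Z T l m ⌈δ * Fintype.card L⌉₊
      (fun y hy => by
        obtain ⟨u, v, p, s, t, E, h1, h2, h3, h4⟩ := hT y hy
        exact ⟨u, v, p, s, t, E, h1, h2, Nat.ceil_le.2 h3, h4⟩) hlt
    have hpow : T.card * l ^ n ≤ Z.card * (m + n) ^ n := by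
      calc T.card * l ^ n ≤ T.card * (n.factorial * (simplex n l).card) :=
            Nat.mul_le_mul_left _ (pow_le_factorial_mul_card_simplex hn l)
        _ = n.factorial * (T.card * (simplex n l).card) := by ring
        _ ≤ n.factorial * (Z.card * (simplex n m).card) := Nat.mul_le_mul_left _ hcard
        _ = Z.card * (n.factorial * (simplex n m).card) := by ring
        _ ≤ _ := Nat.mul_le_mul_left _ (factorial_mul_card_simplex_le n m)
    have hpow' : (T.card : ℝ) * (l : ℝ) ^ n ≤ Z.card * ((m : ℝ) + n) ^ n := by exact_mod_cast hpow
    have hmle : (m : ℝ) + n ≤ (1 + S.card / δ + C * (1 / (l : ℝ))) * l := by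
      have h1 : (m : ℝ) ≤ l + (r + 1) := by
        rw [hm]
        push_cast
        gcongr
        exact Nat.floor_le hr0
      have h2 : (1 + S.card / δ + C * (1 / (l : ℝ))) * l = l + (r + 1) + n := by
        rw [hC, hr]
        field_simp
        ring
      linarith
    have h4 : (T.card : ℝ) * (l : ℝ) ^ n ≤
        Z.card * (1 + S.card / δ + C * (1 / (l : ℝ))) ^ n * (l : ℝ) ^ n := by
      refine hpow'.trans ?_
      rw [mul_assoc, ← mul_pow]
      gcongr
    exact le_of_mul_le_mul_right h4 (by positivity)
  have hlim : Filter.Tendsto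
      (fun l : ℕ => (Z.card : ℝ) * (1 + S.card / δ + C * (1 / (l : ℝ))) ^ n) Filter.atTop
      (nhds (Z.card * (1 + S.card / δ + C * 0) ^ n)) :=
    (((tendsto_one_div_atTop_nhds_zero_nat (𝕜 := ℝ)).const_mul C).const_add _ |>.pow n).const_mul _
  rw [mul_zero, add_zero] at hlim
  exact ge_of_tendsto hlim (Filter.eventually_atTop.2 ⟨1, fun l hl => hbound l hl⟩)

end Extension

theorem exists_quadratic_extension (F : Type*) [Field F] [Finite F] :
    ∃ (L : Type) (_ : Field L) (_ : Fintype L) (_ : Algebra F L), Module.finrank F L = 2 := by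
  obtain ⟨p, hp⟩ := CharP.exists F
  have : Fact p.Prime := ⟨CharP.char_is_prime F p⟩
  exact ⟨FiniteField.Extension F p 2, inferInstance, Fintype.ofFinite _, inferInstance,
    FiniteField.finrank_extension F p 2⟩

section Main

variable {F : Type*} [Field F] [Finite F] {n : ℕ}

/-- The number of points of a rich shift of a plane, in the coordinates of a basis. -/
theorem exists_parametrization {A : Submodule F (Fin n → F)} (hA : Module.finrank F A = 2)
    {K : Set (Fin n → F)} {m : ℝ} {a : Fin n → F} (h : IsRich m K (shift a A)) :
    ∃ (u v : Fin n → F) (E : Finset (F × F)), (∀ x ∈ E, a + x.1 • u + x.2 • v ∈ K) ∧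
      m ≤ E.card ∧ ∀ b ∈ A, ∃ s t : F, b = s • u + t • v := by
  classical
  have := Fintype.ofFinite F
  let b := Module.finBasisOfFinrankEq F A hA
  have hrep : ∀ y ∈ A, ∃ s t : F, y = s • (b 0 : Fin n → F) + t • (b 1 : Fin n → F) := by
    intro y hy
    have := congrArg Subtype.val (b.sum_repr ⟨y, hy⟩)
    rw [Fin.sum_univ_two] at this
    exact ⟨_, _, this.symm⟩
  refine ⟨b 0, b 1, Finset.univ.filter fun x : F × F =>
    a + x.1 • (b 0 : Fin n → F) + x.2 • (b 1 : Fin n → F) ∈ K, ?_, ?_, hrep⟩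
  · intro x hx
    exact (Finset.mem_filter.1 hx).2
  · refine le_trans h (Nat.cast_le.2 ?_)
    rw [← Set.ncard_coe_finset]
    refine le_trans (Set.ncard_le_ncard ?_ (Set.toFinite _)) (Set.ncard_image_le (f := fun x : F × F =>
      a + x.1 • (b 0 : Fin n → F) + x.2 • (b 1 : Fin n → F)) (Set.toFinite _))
    rintro _ ⟨⟨y, hy, rfl⟩, hyK⟩
    obtain ⟨s, t, rfl⟩ := hrep y hy
    refine ⟨(s, t), ?_, ?_⟩
    · simpa [add_assoc] using hyK
    · simp [add_assoc]

theorem mul_pow_le_card_mul_pow (hn : 2 ≤ n) {γ β : ℝ} (hγ : 0 < γ) {K : Set (Fin n → F)}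
    (hK : IsFurstenberg 2 (γ * (Nat.card F : ℝ) ^ 2) β K) :
    β * ((Nat.card F : ℝ) ^ n) ^ 2 ≤ K.ncard * (1 + Nat.card F / γ) ^ n := by
  classical
  have := Fintype.ofFinite F
  obtain ⟨L, _, _, _, hL⟩ := exists_quadratic_extension F
  have hcardL : Fintype.card L = Fintype.card F ^ 2 := by
    rw [← hL]; exact Module.card_eq_pow_finrank
  let θ := Module.finBasisOfFinrankEq F L hL
  let ι : (Fin n → F) → (Fin n → L) := fun x i => algebraMap F L (x i)
  have hι : ∀ (a u v : Fin n → F) (s t : F), ι (a + s • u + t • v) =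
      ι a + algebraMap F L s • ι u + algebraMap F L t • ι v := by
    intro a u v s t
    ext i
    simp [ι, Algebra.smul_def]
  have hinj := (algebraMap F L).injective
  set 𝒢 := {A ∈ subspaces F n 2 | ∃ a : Fin n → F, IsRich (γ * (Nat.card F : ℝ) ^ 2) K (shift a A)}
    with h𝒢
  set T := {c : (Fin n → F) × (Fin n → F) | ∃ A ∈ 𝒢, c.1 ∈ A ∧ c.2 ∈ A} with hT
  have hTcard := mul_card_le_card_pairs (F := F) (V := Fin n → F) (by simpa using hn)
    (𝒢 := 𝒢) (fun A hA => hA.1) hK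
  let ψ : (Fin n → F) × (Fin n → F) → (Fin n → L) := fun c => θ 0 • ι c.1 + θ 1 • ι c.2
  have hψ : Function.Injective ψ := by
    intro c c' h
    have hi : ∀ i, c.1 i = c'.1 i ∧ c.2 i = c'.2 i := by
      intro i
      have h1 := congrFun h i
      have h2 : ∀ c : (Fin n → F) × (Fin n → F),
          ψ c i = ∑ j, (![c.1 i, c.2 i] : Fin 2 → F) j • θ j := by
        intro c
        simp [ψ, ι, Algebra.smul_def, mul_comm]
      rw [h2, h2] at h1
      have h3 := θ.ext_elem_iff.1 h1
      have h4 := h3 0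
      have h5 := h3 1
      rw [θ.repr_sum_self, θ.repr_sum_self] at h4 h5
      exact ⟨h4, h5⟩
    exact Prod.ext (funext fun i => (hi i).1) (funext fun i => (hi i).2)
  have hιinj : Function.Injective ι := fun x y h => funext fun i => hinj (congrFun h i)
  have hmain := card_le_card_mul_pow (L := L) (n := n) (by omega)
    (Finset.univ.image (algebraMap F L)) (K.toFinset.image ι) (T.toFinset.image ψ) hγ (by
      intro y hy
      obtain ⟨c, hc, rfl⟩ := Finset.mem_image.1 hy
      rw [Set.mem_toFinset] at hc
      obtain ⟨A, ⟨hA, a, ha⟩, h1, h2⟩ := hc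
      obtain ⟨u, v, E, hEK, hEcard, hrep⟩ := exists_parametrization hA ha
      obtain ⟨s₁, t₁, hc1⟩ := hrep _ h1
      obtain ⟨s₂, t₂, hc2⟩ := hrep _ h2
      refine ⟨ι u, ι v, ι a, θ 0 * algebraMap F L s₁ + θ 1 * algebraMap F L s₂,
        θ 0 * algebraMap F L t₁ + θ 1 * algebraMap F L t₂,
        E.image (Prod.map (algebraMap F L) (algebraMap F L)), ?_, ?_, ?_, ?_⟩
      · intro x hx
        obtain ⟨x, -, rfl⟩ := Finset.mem_image.1 hx
        simp
      · intro x hx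
        obtain ⟨z, hz, rfl⟩ := Finset.mem_image.1 hx
        refine Finset.mem_image.2 ⟨_, Set.mem_toFinset.2 (hEK z hz), hι _ _ _ _ _⟩
      · rw [Finset.card_image_of_injective _ (hinj.prodMap hinj), hcardL]
        simpa [Nat.card_eq_fintype_card] using hEcard
      · ext i
        simp [ψ, ι, hc1, hc2]
        ring)
  rw [Finset.card_image_of_injective _ hψ, Finset.card_image_of_injective _ hιinj,
    Finset.card_image_of_injective _ hinj, Finset.card_univ, ← Set.ncard_eq_toFinset_card',
    ← Set.ncard_eq_toFinset_card', ← Nat.card_eq_fintype_card] at hmain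
  refine le_trans (le_of_eq ?_) (hTcard.trans hmain)
  rw [Nat.card_prod, Nat.card_fun, Nat.card_eq_fintype_card (α := Fin n), Fintype.card_fin]
  push_cast
  ring

end Main

end Furstenberg

theorem mainTheorem9 (F : Type*) [Field F] [Finite F] (n : ℕ) (hn : 2 ≤ n) (γ β : ℝ)
    (hγ : γ ∈ Set.Icc (0 : ℝ) 1) (hβ : β ∈ Set.Icc (0 : ℝ) 1) (K : Set (Fin n → F))
    (hK : Furstenberg.IsFurstenberg 2 (γ * (Nat.card F : ℝ) ^ 2) β K) :
    β * γ ^ n * (Nat.card F : ℝ) ^ n * ((1 + 1 / (Nat.card F : ℝ)) ^ n)⁻¹ ≤ (K.ncard : ℝ) := by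
  rcases hγ.1.eq_or_lt with rfl | hγ0
  · simp [show n ≠ 0 by omega]
  have h := Furstenberg.mul_pow_le_card_mul_pow hn hγ0 hK
  have hq : (0 : ℝ) < Nat.card F := by exact_mod_cast Nat.card_pos
  set q := (Nat.card F : ℝ)
  rw [← div_eq_mul_inv, div_le_iff₀ (by positivity)]
  have hle : 1 + q / γ ≤ q / γ * (1 + 1 / q) := by
    have h1 : q / γ * (1 + 1 / q) = q / γ + 1 / γ := by field_simp
    have h2 : 1 ≤ 1 / γ := by rw [le_div_iff₀ hγ0, one_mul]; exact hγ.2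
    linarith
  have h2 : β * (q ^ n) ^ 2 ≤ K.ncard * ((q / γ) ^ n * (1 + 1 / q) ^ n) := by
    refine h.trans ?_
    rw [← mul_pow]
    gcongr
  have h3 : 0 < (q / γ) ^ n := by positivity
  refine le_of_mul_le_mul_left ?_ h3
  calc (q / γ) ^ n * (β * γ ^ n * q ^ n) = β * (q ^ n) ^ 2 := by
        rw [div_pow]; field_simp
    _ ≤ _ := h2
    _ = _ := by ring
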